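/- **Conventions.** A circuit is a Boolean circuit whose gates are constants and arbitrary Boolean functions of two bits; its size $|\mathsf C|$ is its number of gates. A probabilistic circuit gets, besides its input, any number of independent uniformly random input bits. An oracle circuit may in addition use gates that query an oracle $\mathsf{Eq}$; each such gate counts as one gate. Two distributions are $(\epsilon,s)$-indistinguishable if every probabilistic circuit of size at most $s$ (without oracle) with one output bit outputs $1$ on them with probabilities that differ by at most $\epsilon$. For jointly distributed bit strings $(X,Z)$ we write $\mathbf H^{\mathrm{unp}}_{\epsilon,s}(X|Z)\ge k$ (*unpredictability entropy*) if there is a joint distribution $(Y,Z)$ with the same $Z$-marginal such that $(X,Z)$ and $(Y,Z)$ are $(\epsilon,s)$-indistinguishable and $$\Pr_{(y,z)\leftarrow (Y,Z)}[\mathsf C(z)=y]\le 2^{-k}$$ for every probabilistic circuit $\mathsf C$ of size at most $s$. We write $\mathbf H^{\mathrm{unp}*}_{\epsilon,s}(X|Z)\ge k$ (*list-unpredictability entropy*) if the same holds when the predictor $\mathsf C$ (but not the distinguishers) may in addition query the oracle $\mathsf{Eq}=\mathsf{Eq}_y$ that outputs $1$ on input $y$ and $0$ on every other input. **Theorem (Condensing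 Unpredictability Entropy).** There is a polynomial $\operatorname{poly}$ in two variables, with $\operatorname{poly}(m,n)>0$ for all $m,n\in\mathbb N$, such that the following holds for all $n,m,k\in\mathbb N$, all real $\epsilon,s$ and every distribution $(X,Z)$ over $\{0,1\}^n\times\{0,1\}^m$. Put $$t=\frac{s}{2^{2k}\operatorname{poly}(m,n)}$$ and assume $t\ge 1$. If $$\mathbf H^{\mathrm{unp}*}_{\epsilon,s}(X|Z)\ge k,$$ then for a uniformly random matrix $R\in\{0,1\}^{k\times n}$, independent of $(X,Z)$, $$\mathbf H^{\mathrm{unp}}_{\epsilon,t}(R.X\,|\,Z,R)\ge k-3,$$ where $R.X\in\{0,1\}^k$ is the matrix-vector product over $\mathbb F_2$. -/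

import Mathlib

open scoped Matrix

noncomputable section

/-- Bit strings with positions indexed by `ι`; the set `{0,1}` of bits is `ZMod 2`. -/
abbrev Bits (ι : Type) : Type := ι → ZMod 2

/-! ### Circuits -/

/-- A gate reading wires from `W`: a constant, an arbitrary Boolean function of two wires, or a
query to one of the oracles, which are indexed by `Q` and take a string indexed by `ι`. -/
inductive Gate (Q ι W : Type) : Type
  | const (b : ZMod 2) : Gate Q ι W
  | op (f : ZMod 2 → ZMod 2 → ZMod 2) (u v : W) : Gate Q ι W
  | query (q : Q) (a : ι → W) : Gate Q ι W

/-- The bit computed by a gate, given the oracles `O` and the values of the wires. -/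
def Gate.eval {Q ι W : Type} (O : Q → Bits ι → ZMod 2) (val : W → ZMod 2) :
    Gate Q ι W → ZMod 2
  | .const b => b
  | .op f u v => f (val u) (val v)
  | .query q a => O q (fun i => val (a i))

/-- A circuit whose available wires are `W` (initially, its inputs) and whose output bits are
indexed by `ο`. It either selects its output wires, or computes one more gate from the available
wires; the rest of the circuit can use the value of this gate (as wire `none`) and all the old
wires (`some w`), with unbounded fan-out. -/
inductive Circuit (Q ι ο : Type) : Type → Type 1
  | output {W : Type} (o : ο → W) : Circuit Q ι ο W
  | gate {W : Type} (g : Gate Q ι W) (c : Circuit Q ι ο (Option W)) : Circuit Q ι ο W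

/-- The size of a circuit: its number of gates. -/
def Circuit.size {Q ι ο : Type} : {W : Type} → Circuit Q ι ο W → ℕ
  | _, .output _ => 0
  | _, .gate _ c => c.size + 1

/-- The output string of a circuit on the input `val`, with oracles `O`. -/
def Circuit.eval {Q ι ο : Type} (O : Q → Bits ι → ZMod 2) :
    {W : Type} → Circuit Q ι ο W → (W → ZMod 2) → Bits ο
  | _, .output o, val => fun i => val (o i)
  | _, .gate g c, val => c.eval O (fun w => w.elim (g.eval O val) val)

/-- Ordinary circuits (no oracle). -/
abbrev PlainCircuit (ο W : Type) : Type 1 := Circuit Empty Empty ο W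

/-- The output of an ordinary circuit. -/
def PlainCircuit.run {ο W : Type} (C : PlainCircuit ο W) (val : Bits W) : Bits ο :=
  Circuit.eval (fun q => q.elim) C val

/-- Circuits with one oracle, which takes strings indexed by `ι`. -/
abbrev OracleCircuit (ι ο W : Type) : Type 1 := Circuit Unit ι ο W

/-- The output of a circuit with oracle `O`. -/
def OracleCircuit.run {ι ο W : Type} (C : OracleCircuit ι ο W) (O : Bits ι → ZMod 2)
    (val : Bits W) : Bits ο :=
  Circuit.eval (fun _ => O) C val

/-- The equality oracle for `y`: it outputs `1` on input `y` and `0` otherwise. -/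
def eqOracle {ι : Type} [Fintype ι] (y : Bits ι) : Bits ι → ZMod 2 :=
  fun v => if v = y then 1 else 0

/-! ### Probability -/

/-- The probability of the event `E` under the distribution `p`, as a real number. -/
def pr {α : Type} (p : PMF α) (E : α → Prop) : ℝ := (p.toOuterMeasure {a | E a}).toReal

/-- The distribution `p` together with an independent uniformly random element of `β`. -/
def withUniform {α : Type} (p : PMF α) (β : Type) [Fintype β] [Nonempty β] : PMF (α × β) :=
  p.bind fun a => (PMF.uniformOfFintype β).map fun b => (a, b)

/-- `p` and `q` are `(ε, s)`-indistinguishable: every probabilistic circuit of size at most `s`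
(with any number `r` of random input bits) with one output bit has advantage at most `ε`. -/
def Indistinguishable {κ : Type} (ε s : ℝ) (p q : PMF (Bits κ)) : Prop :=
  ∀ (r : ℕ) (C : PlainCircuit Unit (κ ⊕ Fin r)), (Circuit.size C : ℝ) ≤ s →
    |pr (withUniform p (Bits (Fin r))) (fun a => C.run (Sum.elim a.1 a.2) () = 1)
      - pr (withUniform q (Bits (Fin r))) (fun a => C.run (Sum.elim a.1 a.2) () = 1)| ≤ ε

/-- The concatenation of the two strings of a pair. -/
def joinBits {ι κ : Type} (a : Bits ι × Bits κ) : Bits (ι ⊕ κ) := Sum.elim a.1 a.2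

/-! ### Unpredictability entropy

In both definitions `P` is the joint distribution of `(X, Z)`, and `P'` that of `(Y, Z)`. -/

/-- `X` has unpredictability entropy at least `k` given `Z`, with parameters `ε` and `s`. -/
def UnpredEntropyGE {ι κ : Type} (ε s k : ℝ) (P : PMF (Bits ι × Bits κ)) : Prop :=
  ∃ P' : PMF (Bits ι × Bits κ),
    P'.map Prod.snd = P.map Prod.snd ∧
    Indistinguishable ε s (P.map joinBits) (P'.map joinBits) ∧
    ∀ (r : ℕ) (C : PlainCircuit ι (κ ⊕ Fin r)), (Circuit.size C : ℝ) ≤ s →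
      pr (withUniform P' (Bits (Fin r))) (fun a => C.run (Sum.elim a.1.2 a.2) = a.1.1)
        ≤ (2 : ℝ) ^ (-k)

/-- `X` has list-unpredictability entropy at least `k` given `Z`, with parameters `ε` and `s`:
the predictor can query the equality oracle for the string that it has to predict. -/
def ListUnpredEntropyGE {ι κ : Type} [Fintype ι] (ε s k : ℝ) (P : PMF (Bits ι × Bits κ)) :
    Prop :=
  ∃ P' : PMF (Bits ι × Bits κ),
    P'.map Prod.snd = P.map Prod.snd ∧
    Indistinguishable ε s (P.map joinBits) (P'.map joinBits) ∧
    ∀ (r : ℕ) (C : OracleCircuit ι ι (κ ⊕ Fin r)), (Circuit.size C : ℝ) ≤ s →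
      pr (withUniform P' (Bits (Fin r)))
          (fun a => C.run (eqOracle a.1.1) (Sum.elim a.1.2 a.2) = a.1.1)
        ≤ (2 : ℝ) ^ (-k)

/-- For `(X, Z)` distributed as `P`, the joint distribution of `(R.X, (Z, R))` where `R` is a
uniformly random `k × n` matrix over `{0,1}` independent of `(X, Z)`. -/
def condensed {n m : ℕ} (k : ℕ) (P : PMF (Bits (Fin n) × Bits (Fin m))) :
    PMF (Bits (Fin k) × Bits (Fin m ⊕ Fin k × Fin n)) :=
  (withUniform P (Matrix (Fin k) (Fin n) (ZMod 2))).map fun a =>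
    (a.2 *ᵥ a.1.1, Sum.elim a.1.2 fun ij => a.2 ij.1 ij.2)

end

/-! If `(Y, Z)` witnesses the hypothesis, `(R.Y, Z, R)` witnesses the conclusion.
Indistinguishability survives because a distinguisher with a fixed `R` hardwired can compute the
product itself. A predictor of `R.Y` with success above `8 / 2^k` is turned into a list decoder for
`Y` in the style of Goldreich and Levin; the equality oracle then picks the right string from the
list.

Let `δ` be the predictor's success on `(y, z)` over random `R`. As `(R + a eᵢᵀ) y = R y + yᵢ a`, its
answer to `R + a eᵢᵀ` is compared with `R y + a` on `h` rows. If `yᵢ = 1`, they agree with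
probability at least `δ`; if `yᵢ = 0`, the mask `a` is independent of the answer and they agree with
probability `2^(-h)`. When `2^h ≥ 4 / δ`, counting agreements over `2^h poly(n)` pairwise
independent samples separates the cases (`expect_threshold_wrong_le`).

On these rows the samples are points of lines over a finite field, so all the products `R y` follow
from one pair of field elements (`Seed.sample_mulVec`). Of the `2^(2h) poly(n)` possible pairs only
`2^h poly(n)` are tried. This succeeds with probability of order `2^(-h)`, hence of order `δ` at the
right scale `h`, which suffices (`exists_candidates_of_scale`). Joining the lists for all `h ≤ k`
gives success above `2^(-k)` (`exists_candidates`). There are `2^k poly(n)` candidates, each calling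
the predictor `2^k poly(n)` times, whence the loss `2^(2k)`. -/

/-! ### Building circuits -/

/-- Redirect the wires read by a gate. -/
def Gate.rename {Q ι W W' : Type} (φ : W → W') : Gate Q ι W → Gate Q ι W'
  | .const b => .const b
  | .op f u v => .op f (φ u) (φ v)
  | .query q a => .query q (φ ∘ a)

theorem Gate.eval_rename {Q ι W W' : Type} (O : Q → Bits ι → ZMod 2) (φ : W → W')
    (val : W' → ZMod 2) (g : Gate Q ι W) : (g.rename φ).eval O val = g.eval O (val ∘ φ) := by
  cases g <;> rfl

namespace Circuit

/-- Redirect the input wires of a circuit. -/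
def rename {Q ι ο : Type} : {W W' : Type} → (W → W') → Circuit Q ι ο W → Circuit Q ι ο W'
  | _, _, φ, .output o => .output (φ ∘ o)
  | _, _, φ, .gate g c => .gate (g.rename φ) (c.rename (Option.map φ))

theorem size_rename {Q ι ο : Type} : ∀ {W W' : Type} (φ : W → W') (c : Circuit Q ι ο W),
    (c.rename φ).size = c.size
  | _, _, _, .output _ => rfl
  | _, _, φ, .gate _ c => congrArg (· + 1) (size_rename (Option.map φ) c)

theorem eval_rename {Q ι ο : Type} (O : Q → Bits ι → ZMod 2) : ∀ {W W' : Type} (φ : W → W')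
    (c : Circuit Q ι ο W) (val : W' → ZMod 2), (c.rename φ).eval O val = c.eval O (val ∘ φ)
  | _, _, _, .output _, _ => rfl
  | _, _, φ, .gate g c, val => by
    simp only [rename, eval, eval_rename O (Option.map φ) c, Gate.eval_rename]
    congr 1
    funext w
    cases w <;> rfl

/-- Run a second circuit on the input and the output of the first one. -/
def andThen {Q ι ο ο' : Type} : {W : Type} → Circuit Q ι ο W → Circuit Q ι ο' (W ⊕ ο) →
    Circuit Q ι ο' W
  | _, .output o, d => d.rename (Sum.elim id o)
  | _, .gate g c, d => .gate g (c.andThen (d.rename (Sum.map some id)))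

theorem size_andThen {Q ι ο ο' : Type} : ∀ {W : Type} (c : Circuit Q ι ο W)
    (d : Circuit Q ι ο' (W ⊕ ο)), (c.andThen d).size = c.size + d.size
  | _, .output _, d => by simp [andThen, size, size_rename]
  | _, .gate g c, d => by
    simp only [andThen, size, size_andThen c, size_rename]
    omega

theorem eval_andThen {Q ι ο ο' : Type} (O : Q → Bits ι → ZMod 2) : ∀ {W : Type}
    (c : Circuit Q ι ο W) (d : Circuit Q ι ο' (W ⊕ ο)) (val : W → ZMod 2),
    (c.andThen d).eval O val = d.eval O (Sum.elim val (c.eval O val))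
  | _, .output o, d, val => by
    simp only [andThen, eval_rename, eval]
    congr 1
    funext w
    cases w <;> rfl
  | _, .gate g c, d, val => by
    simp only [andThen, eval, eval_andThen O c, eval_rename]
    congr 1
    funext w
    cases w <;> rfl

/-- An ordinary circuit, seen as a circuit that could query oracles. -/
def addOracles {ο : Type} (Q ι : Type) : {W : Type} → PlainCircuit ο W → Circuit Q ι ο W
  | _, .output o => .output o
  | _, .gate (.const b) c => .gate (.const b) (c.addOracles Q ι)
  | _, .gate (.op f u v) c => .gate (.op f u v) (c.addOracles Q ι)
  | _, .gate (.query q _) _ => q.elim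

theorem size_addOracles {ο Q ι : Type} : ∀ {W : Type} (c : PlainCircuit ο W),
    (c.addOracles Q ι).size = c.size
  | _, .output _ => rfl
  | _, .gate (.const _) c => congrArg (· + 1) (size_addOracles c)
  | _, .gate (.op _ _ _) c => congrArg (· + 1) (size_addOracles c)
  | _, .gate (.query q _) _ => q.elim

theorem eval_addOracles {ο Q ι : Type} (O : Q → Bits ι → ZMod 2) : ∀ {W : Type}
    (c : PlainCircuit ο W) (val : W → ZMod 2),
    (c.addOracles Q ι).eval O val = PlainCircuit.run c val
  | _, .output _, _ => rfl
  | _, .gate (.const _) c, _ => eval_addOracles O c _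
  | _, .gate (.op _ _ _) c, _ => eval_addOracles O c _
  | _, .gate (.query q _) _, _ => q.elim

end Circuit

/-! ### Size bounds for functions computed by circuits -/

/-- The functions `F x`, for `x : Ω`, are computed by a single circuit of size at most `s`, which
has the oracles `orc x` when it is to compute `F x`. -/
def Computes {Ω Q ι W ο : Type} (orc : Ω → Q → Bits ι → ZMod 2) (s : ℕ)
    (F : Ω → Bits W → Bits ο) : Prop :=
  ∃ C : Circuit Q ι ο W, C.size ≤ s ∧ ∀ x v, C.eval (orc x) v = F x v

/-- The one-bit case of `Computes`. -/
abbrev ComputesBit {Ω Q ι W : Type} (orc : Ω → Q → Bits ι → ZMod 2) (s : ℕ)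
    (F : Ω → Bits W → ZMod 2) : Prop :=
  Computes orc s (ο := Unit) fun x v _ => F x v

namespace Computes

variable {Ω Q ι W W' ο ο' : Type} {orc : Ω → Q → Bits ι → ZMod 2}

theorem mono {s s' : ℕ} {F : Ω → Bits W → Bits ο} (h : Computes orc s F) (hs : s ≤ s') :
    Computes orc s' F := by
  obtain ⟨C, hC, hF⟩ := h
  exact ⟨C, hC.trans hs, hF⟩

theorem congr {s s' : ℕ} {F G : Ω → Bits W → Bits ο} (h : Computes orc s F) (hs : s ≤ s')
    (hFG : ∀ x v i, F x v i = G x v i) : Computes orc s' G := by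
  obtain ⟨C, hC, hF⟩ := h
  exact ⟨C, hC.trans hs, fun x v => (hF x v).trans (funext (hFG x v))⟩

theorem of_plain (C : PlainCircuit ο W) :
    Computes orc (Circuit.size C) fun _ v => PlainCircuit.run C v :=
  ⟨C.addOracles Q ι, (Circuit.size_addOracles C).le, fun _ _ => Circuit.eval_addOracles _ C _⟩

theorem select (o : ο → W) : Computes orc 0 fun _ v i => v (o i) :=
  ⟨.output o, le_rfl, fun _ _ => rfl⟩

theorem andThen {s s' : ℕ} {F : Ω → Bits W → Bits ο} {G : Ω → Bits (W ⊕ ο) → Bits ο'}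
    (hF : Computes orc s F) (hG : Computes orc s' G) :
    Computes orc (s + s') fun x v => G x (Sum.elim v (F x v)) := by
  obtain ⟨C, hC, hCF⟩ := hF
  obtain ⟨D, hD, hDG⟩ := hG
  refine ⟨C.andThen D, ?_, fun x v => ?_⟩
  · rw [Circuit.size_andThen]
    omega
  · rw [Circuit.eval_andThen, hCF, hDG]

theorem rename {s : ℕ} {F : Ω → Bits W → Bits ο} (hF : Computes orc s F) (φ : W → W') :
    Computes orc s fun x v => F x (v ∘ φ) := by
  obtain ⟨C, hC, hCF⟩ := hF
  exact ⟨C.rename φ, (Circuit.size_rename φ C).le.trans hC, fun x v => by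
    rw [Circuit.eval_rename, hCF]⟩

theorem comp {s s' : ℕ} {F : Ω → Bits W → Bits ο} {G : Ω → Bits ο → Bits ο'}
    (hF : Computes orc s F) (hG : Computes orc s' G) :
    Computes orc (s + s') fun x v => G x (F x v) :=
  hF.andThen (hG.rename Sum.inr)

theorem prod {s s' : ℕ} {F : Ω → Bits W → Bits ο} {G : Ω → Bits W → Bits ο'}
    (hF : Computes orc s F) (hG : Computes orc s' G) :
    Computes orc (s + s') fun x v => Sum.elim (F x v) (G x v) := by
  have h := hF.andThen ((hG.rename (Sum.inl : W → W ⊕ ο)).andThen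
    (select (orc := orc) (Sum.map Sum.inr id : ο ⊕ ο' → (W ⊕ ο) ⊕ ο')))
  exact h.congr le_rfl fun x v i => by cases i <;> rfl

theorem const (b : ZMod 2) : ComputesBit orc 1 fun _ (_ : Bits W) => b :=
  ⟨.gate (.const b) (.output fun _ => none), le_rfl, fun _ _ => rfl⟩

theorem query (q : Q) (a : ι → W) : ComputesBit orc 1 fun x v => orc x q fun i => v (a i) :=
  ⟨.gate (.query q a) (.output fun _ => none), le_rfl, fun _ _ => rfl⟩

theorem wire (w : W) : ComputesBit orc 0 fun _ v => v w := select fun _ => w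

theorem op {s s' : ℕ} {F G : Ω → Bits W → ZMod 2} (f : ZMod 2 → ZMod 2 → ZMod 2)
    (hF : ComputesBit orc s F) (hG : ComputesBit orc s' G) :
    ComputesBit orc (s + s' + 1) fun x v => f (F x v) (G x v) := by
  have h : ComputesBit orc 1 fun _ (v : Bits (Unit ⊕ Unit)) => f (v (.inl ())) (v (.inr ())) :=
    ⟨.gate (.op f (.inl ()) (.inr ())) (.output fun _ => none), le_rfl, fun _ _ => rfl⟩
  exact (prod hF hG).comp h

theorem tuple [Fintype ο] {s : ℕ} {F : ο → Ω → Bits W → ZMod 2}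
    (h : ∀ i, ComputesBit orc s (F i)) :
    Computes orc (Fintype.card ο * s) fun x v i => F i x v := by
  have key : ∀ (N : ℕ) (G : Fin N → Ω → Bits W → ZMod 2), (∀ i, ComputesBit orc s (G i)) →
      Computes orc (N * s) fun x v i => G i x v := by
    intro N
    induction N with
    | zero =>
      exact fun G _ => (select (Fin.elim0 : Fin 0 → W)).congr (Nat.zero_le _) fun x v i => i.elim0
    | succ N ih =>
      intro G hG
      have h1 := ((ih (fun i => G i.castSucc) fun i => hG _).prod (hG (Fin.last N))).comp
        (select (orc := orc) (Fin.lastCases (Sum.inr ()) Sum.inl : Fin (N + 1) → Fin N ⊕ Unit))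
      refine h1.congr (by rw [Nat.succ_mul]; rfl) fun x v i => ?_
      refine Fin.lastCases ?_ (fun i => ?_) i <;> simp
  have h1 := (key _ (fun i => F ((Fintype.equivFin ο).symm i)) fun i => h _).comp
    (select (orc := orc) (Fintype.equivFin ο))
  simpa using h1

/-- Feed each input wire with another wire or with a constant. -/
theorem hardwire {s : ℕ} {F : Ω → Bits W' → Bits ο} (hF : Computes orc s F)
    (σ : W' → W ⊕ ZMod 2) :
    Computes orc (s + 2) fun x (v : Bits W) => F x fun w => (σ w).elim v id := by
  have h := (tuple (W := W) (F := fun b _ _ => b) fun b : ZMod 2 => const (orc := orc) b).andThen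
    (hF.rename σ)
  refine h.congr (by simp [ZMod.card]; omega) fun x v i => ?_
  rfl

/-- Comparison with a constant string, on a set of positions. -/
theorem matchConst [DecidableEq W] (A : Finset W) (w : Bits W) :
    ComputesBit orc (A.card + 1) fun _ v => if ∀ r ∈ A, v r = w r then 1 else 0 := by
  induction A using Finset.induction_on with
  | empty => simpa using const (orc := orc) (W := W) 1
  | insert r A hr ih =>
    have h := op (fun a b => if a = 1 ∧ b = w r then 1 else 0) ih (wire r)
    refine h.congr (by rw [Finset.card_insert_of_notMem hr]) fun x v _ => ?_
    by_cases h1 : v r = w r <;> by_cases h2 : ∀ r ∈ A, v r = w r <;>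
      simp_all

/-- The parity of a set of wires. -/
theorem parity (A : Finset W) : ComputesBit orc (A.card + 1) fun _ v => ∑ r ∈ A, v r := by
  classical
  induction A using Finset.induction_on with
  | empty => simpa using const (orc := orc) (W := W) 0
  | insert r A hr ih =>
    have h := op (· + ·) ih (wire r)
    refine h.congr (by rw [Finset.card_insert_of_notMem hr]) fun x v _ => ?_
    simp [Finset.sum_insert hr, add_comm]

/-- Whether at least `T` of the given bits are `1`. -/
theorem threshold {J : Type} (A : Finset J) {s : ℕ} (b : J → Ω → Bits W → ZMod 2)
    (hb : ∀ j, ComputesBit orc s (b j)) (T : ℕ) :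
    ComputesBit orc (A.card * ((T + 1) * (s + 2)) + (T + 1)) fun x v =>
      if T ≤ (A.filter fun j => b j x v = 1).card then 1 else 0 := by
  classical
  -- Wire `i` records whether the count so far is at least `i`. A new sample sets it if it was set,
  -- or if wire `i - 1` was set and the sample is 1.
  have key : Computes orc (A.card * ((T + 1) * (s + 2)) + (T + 1))
      fun x v (i : Fin (T + 1)) =>
        if (i : ℕ) ≤ (A.filter fun j => b j x v = 1).card then 1 else 0 := by
    induction A using Finset.induction_on with
    | empty =>
      have h := tuple (W := W) (F := fun (i : Fin (T + 1)) _ _ => if (i : ℕ) ≤ 0 then 1 else 0)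
        fun i => const (orc := orc) _
      simpa using h
    | insert j A hj ih =>
      have h1 : ∀ i : Fin (T + 1), ComputesBit orc (s + 2)
          fun x (v : Bits (W ⊕ Fin (T + 1))) =>
            if v (.inr i) = 1 ∨ (v (.inr (i - 1)) = 1 ∧ b j x (v ∘ Sum.inl) = 1)
              then 1 else 0 := by
        intro i
        have h2 := op (fun a c => if a = 1 ∨ c = 1 then 1 else 0) (wire (orc := orc) (.inr i))
          (op (fun a c => if a = 1 ∧ c = 1 then 1 else 0) (wire (orc := orc) (.inr (i - 1)))
            ((hb j).rename (Sum.inl : W → W ⊕ Fin (T + 1))))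
        refine h2.congr (by omega) fun x v _ => ?_
        simp
      refine (ih.andThen (tuple h1)).congr ?_ fun x v i => ?_
      · rw [Finset.card_insert_of_notMem hj, Fintype.card_fin]
        apply le_of_eq
        ring
      · simp only [Sum.elim_comp_inl, Sum.elim_inr, Finset.filter_insert]
        -- For `i = 0` the index `i - 1` wraps around to `T`; this is harmless since wire 0 is
        -- always 1.
        have h3 : (i : ℕ) = 0 ∨ ((i - 1 : Fin (T + 1)) : ℕ) + 1 = i := by
          by_cases hi : i = 0
          · simp [hi]
          · right
            rw [Fin.val_sub_one_of_ne_zero hi]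
            have : (i : ℕ) ≠ 0 := fun h => hi (Fin.ext h)
            omega
        by_cases hbj : b j x v = 1
        · rw [if_pos hbj, Finset.card_insert_of_notMem (by simp [hj])]
          simp only [hbj, and_true]
          congr 1
          simp only [ite_eq_left_iff, zero_ne_one, imp_false, not_not]
          exact propext (by omega)
        · rw [if_neg hbj]
          simp [hbj]
  have h := key.comp (wire (orc := orc) (Fin.last T))
  simpa using h

end Computes

namespace Computes

variable {Ω Q ι W : Type} {orc : Ω → Q → Bits ι → ZMod 2}

/-- Try a list of candidates with the equality oracle. -/
theorem search [Fintype ι] {s : ℕ} (l : List (Bits W → Bits ι))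
    (hl : ∀ D ∈ l, Computes (fun (y : Bits ι) (_ : Unit) => eqOracle y) s fun _ v => D v) :
    ∃ F : Bits ι → Bits W → Bits ι,
      Computes (fun (y : Bits ι) (_ : Unit) => eqOracle y)
        (l.length * (s + 1 + Fintype.card ι * 2) + Fintype.card ι) F ∧
      ∀ y v, F y v = if ∃ D ∈ l, D v = y then y else 0 := by
  induction l with
  | nil =>
    exact ⟨fun _ _ _ => 0, (tuple fun _ => const 0).mono (by simp), fun y v => by simp; rfl⟩
  | cons D l ih =>
    obtain ⟨F, hF, hFv⟩ := ih fun E hE => hl E (List.mem_cons_of_mem _ hE)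
    -- The answer of the oracle masks the new candidate, which is then OR-ed bitwise into the result
    -- so far. That result is 0 or already `y`, so repeated hits do no damage.
    have h1 := hF.andThen (((hl D List.mem_cons_self).rename (Sum.inl : W → W ⊕ ι)).andThen
      ((query () Sum.inr).andThen (tuple fun i : ι =>
        op (fun a b => if a = 1 ∨ b = 1 then 1 else 0) (wire (.inl (.inl (.inr i))))
          (op (fun a b => if a = 1 ∧ b = 1 then 1 else 0) (wire (.inr ()))
            (wire (.inl (.inr i)))))))
    refine ⟨_, h1.mono ?_, fun y v => ?_⟩
    · apply le_of_eq
      simp only [List.length_cons]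
      ring
    · have hbit : ∀ b : ZMod 2, (if b = 1 then (1 : ZMod 2) else 0) = b := by decide
      funext i
      simp only [Sum.elim_inl, Sum.elim_inr, hFv, eqOracle, List.mem_cons,
        exists_eq_or_imp]
      by_cases h2 : D v = y <;> by_cases h3 : ∃ E ∈ l, E v = y <;> simp [h2, h3, hbit]

end Computes

/-- Decode `n` bits from the answers of `f`: bit `i` is `1` if for at least `T` of the indices `j`
the answer to `M j i` agrees with `w j` on the positions in `A`. -/
def thresholdDecode {m n k : ℕ} {J : Type} [Fintype J]
    (f : Bits (Fin m) → Matrix (Fin k) (Fin n) (ZMod 2) → Bits (Fin k)) (A : Finset (Fin k))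
    (T : ℕ) (M : J → Fin n → Matrix (Fin k) (Fin n) (ZMod 2)) (w : J → Bits (Fin k))
    (z : Bits (Fin m)) : Bits (Fin n) :=
  fun i => if T ≤ (Finset.univ.filter fun j => ∀ r ∈ A, f z (M j i) r = w j r).card then 1 else 0

open Computes in
theorem computes_thresholdDecode {Ω Q ι : Type} {orc : Ω → Q → Bits ι → ZMod 2}
    {m n k s : ℕ} {J : Type} [Fintype J]
    {f : Bits (Fin m) → Matrix (Fin k) (Fin n) (ZMod 2) → Bits (Fin k)}
    (hf : ∀ R, Computes orc s fun _ z => f z R) (A : Finset (Fin k))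
    (T : ℕ) (M : J → Fin n → Matrix (Fin k) (Fin n) (ZMod 2)) (w : J → Bits (Fin k)) :
    Computes orc (n * (Fintype.card J * ((T + 1) * (s + k + 3)) + (T + 1)))
      fun _ z => thresholdDecode f A T M w z := by
  have h1 : ∀ i : Fin n, ComputesBit orc
      (Fintype.card J * ((T + 1) * (s + k + 3)) + (T + 1)) fun _ z =>
        thresholdDecode f A T M w z i := by
    intro i
    have h2 := threshold (Finset.univ : Finset J) _
      (fun j => (hf (M j i)).comp (matchConst A (w j))) T
    refine h2.congr ?_ fun _ z _ => ?_
    · have : A.card ≤ k := A.card_le_univ.trans (Fintype.card_fin k).le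
      rw [Finset.card_univ]
      have h3 : s + (A.card + 1) + 2 ≤ s + k + 3 := by omega
      gcongr
    · simp [thresholdDecode]
  exact (tuple h1).congr (by simp) fun _ _ _ => rfl

/-! ### Pairwise independent sampling -/

open Finset BigOperators in
/-- A surjective homomorphism maps uniform elements to uniform elements. -/
theorem expect_comp_of_surjective {G H : Type*} [AddGroup G] [AddGroup H] [Fintype G] [Fintype H]
    (φ : G →+ H) (hφ : Function.Surjective φ) (F : H → ℝ) :
    𝔼 g, F (φ g) = 𝔼 h, F h := by
  have h1 : ∀ h, 𝔼 g, F (φ g + h) = 𝔼 g, F (φ g) := by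
    intro h
    obtain ⟨g₀, rfl⟩ := hφ h
    exact Fintype.expect_equiv (Equiv.addRight g₀) _ _ fun g => by simp
  have h2 : ∀ g, 𝔼 h, F (φ g + h) = 𝔼 h, F h := fun g =>
    Fintype.expect_equiv (Equiv.addLeft (φ g)) _ _ fun h => by simp
  calc 𝔼 g, F (φ g) = 𝔼 h : H, 𝔼 g, F (φ g + h) := by simp [h1]
    _ = 𝔼 g : G, 𝔼 h, F (φ g + h) := expect_comm _ _ _
    _ = _ := by simp [h2]

open Finset BigOperators in
/-- The second moment of a sum of pairwise independent indicators. -/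
theorem expect_sq_sub_le {Ω J : Type*} [Fintype Ω] [Nonempty Ω] [Fintype J]
    (X : J → Ω → ℝ) (p : ℝ) (hX : ∀ j ω, X j ω * X j ω = X j ω) (h1 : ∀ j, 𝔼 ω, X j ω = p)
    (h2 : ∀ i j, i ≠ j → 𝔼 ω, X i ω * X j ω = p * p) :
    𝔼 ω, (∑ j, X j ω - Fintype.card J * p) ^ 2 ≤ Fintype.card J * p := by
  classical
  set N : ℝ := (Fintype.card J : ℝ)
  have hs : 𝔼 ω, ∑ j, X j ω = N * p := by
    rw [expect_sum_comm]
    simp [h1, N]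
  have hss : 𝔼 ω, (∑ i, X i ω) * (∑ j, X j ω) = N * p + N * (N - 1) * (p * p) := by
    simp_rw [sum_mul_sum]
    rw [expect_sum_comm]
    simp_rw [expect_sum_comm]
    have : ∀ i j, 𝔼 ω, X i ω * X j ω = p * p + if i = j then p - p * p else 0 := by
      intro i j
      split_ifs with h
      · subst h
        simp [hX, h1]
      · simp [h2 i j h]
    simp_rw [this, sum_add_distrib]
    simp
    ring
  have : 𝔼 ω, (∑ j, X j ω - N * p) ^ 2 = N * p + N * (N - 1) * (p * p) - (N * p) ^ 2 := by
    have : ∀ ω, (∑ j, X j ω - N * p) ^ 2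
        = (∑ i, X i ω) * (∑ j, X j ω) - (2 * (N * p)) * (∑ j, X j ω) + (N * p) ^ 2 := by
      intro ω
      ring
    simp_rw [this, expect_add_distrib, expect_sub_distrib, ← mul_expect, hs, hss,
      Fintype.expect_const]
    ring
  rw [this]
  have : 0 ≤ N * (p * p) := mul_nonneg (Nat.cast_nonneg _) (mul_self_nonneg _)
  nlinarith

open Finset BigOperators in
/-- Chebyshev's inequality for pairwise independent samples: whether at least `T` samples lie in
`S` tells apart density at least `2 * T / |J|` from density at most `T / (2 * |J|)`. -/
theorem expect_threshold_wrong_le {Ω G J : Type*} [AddGroup Ω] [Fintype Ω] [AddGroup G] [Fintype G]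
    [Fintype J] [Nontrivial J] (π : J → Ω →+ G)
    (hπ : ∀ i j, i ≠ j → Function.Surjective fun ω => (π i ω, π j ω))
    (S : G → Prop) [DecidablePred S] (T : ℕ) (hT : 0 < T) (b : Prop) [Decidable b]
    (hb : b → 2 * (T : ℝ) ≤ Fintype.card J * 𝔼 g, if S g then 1 else 0)
    (hnb : ¬ b → Fintype.card J * (𝔼 g, if S g then 1 else 0) ≤ (T : ℝ) / 2) :
    𝔼 ω, (if T ≤ (univ.filter fun j => S (π j ω)).card ↔ b then (0 : ℝ) else 1) ≤ 2 / T := by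
  set p : ℝ := 𝔼 g, if S g then 1 else 0
  set N : ℝ := (Fintype.card J : ℝ)
  have hT' : (0 : ℝ) < T := by exact_mod_cast hT
  have hN : 0 ≤ N * p :=
    mul_nonneg (Nat.cast_nonneg _) (expect_nonneg fun g _ => by split_ifs <;> norm_num)
  have hm := expect_sq_sub_le (fun j ω => if S (π j ω) then (1 : ℝ) else 0) p
    (fun j ω => by split_ifs <;> norm_num)
    (fun j => expect_comp_of_surjective (π j) (fun g => by
      obtain ⟨i, hi⟩ := exists_ne j
      obtain ⟨ω, hω⟩ := hπ j i hi.symm (g, 0)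
      exact ⟨ω, congrArg Prod.fst hω⟩) fun g => if S g then 1 else 0)
    (fun i j hij => by
      have := expect_comp_of_surjective ((π i).prod (π j)) (hπ i j hij)
        fun g => (if S g.1 then (1 : ℝ) else 0) * if S g.2 then (1 : ℝ) else 0
      simp only [AddMonoidHom.prod_apply] at this
      refine this.trans ?_
      rw [← univ_product_univ, expect_product]
      exact (Fintype.expect_mul_expect (fun g => if S g then (1 : ℝ) else 0)
        fun g => if S g then (1 : ℝ) else 0).symm)
  set d : ℝ := N * p - T
  -- A wrong verdict forces a deviation of at least `|d|` from the mean `N * p`. The ratio `N * p /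
  -- d ^ 2` is largest at the extremes `N * p = 2 * T` and `N * p = T / 2`, where it equals `2 / T`.
  have hd : d ≠ 0 ∧ N * p / d ^ 2 ≤ 2 / T := by
    by_cases h : b
    · have := hb h
      have hd0 : 0 < d := by simp only [d]; linarith
      refine ⟨hd0.ne', ?_⟩
      rw [div_le_div_iff₀ (by positivity) hT']
      simp only [d] at hd0 ⊢
      nlinarith
    · have := hnb h
      have hd0 : d < 0 := by simp only [d]; linarith
      refine ⟨hd0.ne, ?_⟩
      rw [div_le_div_iff₀ ((sq_nonneg d).lt_of_ne' (pow_ne_zero 2 hd0.ne)) hT']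
      simp only [d] at hd0 ⊢
      nlinarith
  refine le_trans ?_ hd.2
  rw [le_div_iff₀ ((sq_nonneg d).lt_of_ne' (pow_ne_zero 2 hd.1)), expect_mul]
  refine le_trans (expect_le_expect fun ω _ => ?_) hm
  rw [sum_boole]
  split_ifs with h
  · rw [zero_mul]
    positivity
  · rw [one_mul]
    by_cases hbb : b
    · have h1 : ¬ T ≤ (univ.filter fun j => S (π j ω)).card := fun h' => h ⟨fun _ => hbb, fun _ => h'⟩
      have h2 : ((univ.filter fun j => S (π j ω)).card : ℝ) ≤ T := by
        exact_mod_cast (not_le.1 h1).le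
      have := hb hbb
      simp only [d]
      nlinarith
    · have h1 : T ≤ (univ.filter fun j => S (π j ω)).card := by tauto
      have h2 : (T : ℝ) ≤ (univ.filter fun j => S (π j ω)).card := by exact_mod_cast h1
      have := hnb hbb
      simp only [d]
      nlinarith

open BigOperators

/-! ### Samples with a short secret -/

/-- A finite field of order `2 ^ e` with linear coordinates, `h ≤ e` of which are arranged as the
first `h` entries of a string of length `k`. -/
theorem exists_field_coordinates (k h e : ℕ) (he : e ≠ 0) (hh : h ≤ e) :
    ∃ (F : Type) (_ : Field F) (_ : Fintype F) (_ : Algebra (ZMod 2) F)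
      (c : F →ₗ[ZMod 2] Bits (Fin k)), Fintype.card F = 2 ^ e ∧
        ∀ w : Bits (Fin k), ∃ x, ∀ r : Fin k, (r : ℕ) < h → c x r = w r := by
  classical
  let F := GaloisField 2 e
  let b := Module.finBasisOfFinrankEq (ZMod 2) F (GaloisField.finrank 2 he)
  let _ := Fintype.ofFinite F
  refine ⟨F, inferInstance, inferInstance, inferInstance,
    LinearMap.pi fun r => if hr : (r : ℕ) < h then b.coord ⟨r, hr.trans_le hh⟩ else 0, ?_, ?_⟩
  · rw [← Nat.card_eq_fintype_card, GaloisField.card 2 e he]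
  · intro w
    refine ⟨b.equivFun.symm fun i => if hi : (i : ℕ) < k then w ⟨i, hi⟩ else 0, fun r hr => ?_⟩
    rw [LinearMap.pi_apply, dif_pos hr, Module.Basis.coord_apply, ← Module.Basis.equivFun_apply,
      LinearEquiv.apply_symm_apply]
    simp

section Decoding

variable {n k : ℕ} {F : Type} [Field F] [Algebra (ZMod 2) F]

/-- The seeds of the pairwise independent samples. -/
abbrev Seed (F : Type) (n k : ℕ) : Type :=
  (Fin n → F × F) × (F → Matrix (Fin k) (Fin n) (ZMod 2)) × (F → Bits (Fin k))

/-- The sample with index `j`: a random matrix, whose entries in the rows in `A` depend on only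
`n` pairs of field elements, and a random string. -/
def Seed.sample (c : F →ₗ[ZMod 2] Bits (Fin k)) (A : Finset (Fin k)) (j : F) :
    Seed F n k →+ Matrix (Fin k) (Fin n) (ZMod 2) × Bits (Fin k) :=
  AddMonoidHom.mk'
    (fun ω => (Matrix.of fun r i => if r ∈ A then c ((ω.1 i).1 + j * (ω.1 i).2) r else ω.2.1 j r i,
      ω.2.2 j))
    (by
      intro ω ω'
      refine Prod.ext ?_ rfl
      ext r i
      simp only [Prod.fst_add, Prod.snd_add, Pi.add_apply, Matrix.of_apply, Matrix.add_apply]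
      split_ifs
      · rw [mul_add, add_add_add_comm, map_add]
        rfl
      · rfl)

/-- A line over `F` can be put through any two values at distinct points `j`, `j'`. The rows outside
`A` and the masks have separate seeds for each index. With additivity, surjectivity onto pairs is
pairwise independence. -/
theorem Seed.sample_pair_surjective (c : F →ₗ[ZMod 2] Bits (Fin k)) (A : Finset (Fin k))
    (hc : ∀ w : Bits (Fin k), ∃ x, ∀ r ∈ A, c x r = w r) (j j' : F) (hj : j ≠ j') :
    Function.Surjective fun ω : Seed F n k => (sample c A j ω, sample c A j' ω) := by
  classical
  rintro ⟨⟨R, a⟩, R', a'⟩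
  choose x hx using fun i => hc fun r => R r i
  choose x' hx' using fun i => hc fun r => R' r i
  have hjj : j - j' ≠ 0 := sub_ne_zero.2 hj
  refine ⟨(fun i => (x i - j * ((x i - x' i) / (j - j')), (x i - x' i) / (j - j')),
    fun l => if l = j then R else R', fun l => if l = j then a else a'), ?_⟩
  have h1 : ∀ i, x i - j * ((x i - x' i) / (j - j')) + j' * ((x i - x' i) / (j - j')) = x' i := by
    intro i
    field_simp
    ring
  refine Prod.ext (Prod.ext ?_ ?_) (Prod.ext ?_ ?_)
  · ext r i
    by_cases hr : r ∈ A
    · simp [sample, hr, hx i r hr]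
    · simp [sample, hr]
  · simp [sample]
  · ext r i
    by_cases hr : r ∈ A
    · simp only [sample, AddMonoidHom.mk'_apply, Matrix.of_apply, hr, if_true, h1, hx' i r hr]
    · simp [sample, hr, hj.symm]
  · simp [sample, hj.symm]

/-- The part of the seed that determines the products of the samples with `y`. -/
def Seed.secret (ω : Seed F n k) (y : Bits (Fin n)) : F × F := ∑ i, y i • ω.1 i

/-- By linearity the products for all `j` lie on a single line, with coefficients `secret`. Guessing
one element of `F × F` therefore replaces knowledge of `y`. -/
theorem Seed.sample_mulVec (c : F →ₗ[ZMod 2] Bits (Fin k)) (A : Finset (Fin k)) (j : F)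
    (ω : Seed F n k) (y : Bits (Fin n)) (r : Fin k) (hr : r ∈ A) :
    ((sample c A j ω).1 *ᵥ y) r = c ((ω.secret y).1 + j * (ω.secret y).2) r := by
  have h1 : (ω.secret y).1 + j * (ω.secret y).2
      = ∑ i, y i • ((ω.1 i).1 + j * (ω.1 i).2) := by
    simp only [secret, Prod.fst_sum, Prod.snd_sum, Prod.smul_fst, Prod.smul_snd, Finset.mul_sum,
      smul_add, Finset.sum_add_distrib, mul_smul_comm]
  rw [h1]
  simp [sample, Matrix.mulVec, dotProduct, hr, mul_comm, mul_add]

/-- The candidate string obtained from a seed and a guess `u` for its secret part. -/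
def seedDecode [Fintype F] {m : ℕ} (f : Bits (Fin m) → Matrix (Fin k) (Fin n) (ZMod 2) → Bits (Fin k))
    (c : F →ₗ[ZMod 2] Bits (Fin k)) (A : Finset (Fin k)) (T : ℕ) (ω : Seed F n k) (u : F × F) :
    Bits (Fin m) → Bits (Fin n) :=
  thresholdDecode f A T
    (fun j i => (Seed.sample c A j ω).1 + Matrix.vecMulVec (Seed.sample c A j ω).2 (Pi.single i 1))
    (fun j => c (u.1 + j * u.2) + (Seed.sample c A j ω).2)

end Decoding

/-- The probability that `g R` is the product of `R` with `y`. -/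
noncomputable def agreement {n k : ℕ} (g : Matrix (Fin k) (Fin n) (ZMod 2) → Bits (Fin k))
    (y : Bits (Fin n)) : ℝ :=
  𝔼 R, if g R = R *ᵥ y then 1 else 0

theorem expect_eq_on {k : ℕ} (A : Finset (Fin k)) (w : Bits (Fin k)) :
    (𝔼 a : Bits (Fin k), if ∀ r ∈ A, w r = a r then (1 : ℝ) else 0) = 1 / 2 ^ A.card := by
  classical
  have h := expect_comp_of_surjective
    (AddMonoidHom.mk' (fun (a : Bits (Fin k)) (r : A) => a r) fun _ _ => rfl)
    (fun b => ⟨fun r => if hr : r ∈ A then b ⟨r, hr⟩ else 0, by ext r; simp⟩)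
    fun b => if (fun r : A => w r) = b then (1 : ℝ) else 0
  simp only [AddMonoidHom.mk'_apply, funext_iff, Subtype.forall] at h
  rw [h]
  simp_rw [← Subtype.forall (p := (· ∈ A)) (q := fun r => w r = _), ← funext_iff]
  rw [Fintype.expect_eq_sum_div_card]
  simp [ZMod.card]

/-! ### Correctness of the decoder -/

section Correctness

open Finset

variable {n k : ℕ} {F : Type} [Field F] [Fintype F] [DecidableEq F] [Algebra (ZMod 2) F]

/-- A single bit is decoded correctly for most seeds. -/
theorem expect_vote_wrong_le (g : Matrix (Fin k) (Fin n) (ZMod 2) → Bits (Fin k))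
    (c : F →ₗ[ZMod 2] Bits (Fin k)) (A : Finset (Fin k))
    (hc : ∀ w : Bits (Fin k), ∃ x, ∀ r ∈ A, c x r = w r) (T : ℕ) (hT : 0 < T) (y : Bits (Fin n))
    (h1 : 2 * (T : ℝ) ≤ Fintype.card F * agreement g y)
    (h2 : (Fintype.card F : ℝ) * (1 / 2 ^ A.card) ≤ T / 2) (i : Fin n) :
    𝔼 ω : Seed F n k, (if T ≤ (univ.filter fun j => ∀ r ∈ A,
        g ((Seed.sample c A j ω).1 + Matrix.vecMulVec (Seed.sample c A j ω).2 (Pi.single i 1)) r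
          = ((Seed.sample c A j ω).1 *ᵥ y + (Seed.sample c A j ω).2) r).card ↔ y i = 1
        then (0 : ℝ) else 1) ≤ 2 / T := by
  classical
  let M := Matrix (Fin k) (Fin n) (ZMod 2)
  -- Passing from the sample to the query is a bijection that keeps the mask, so the query is
  -- uniform and independent of the mask.
  let shift : M × Bits (Fin k) →+ M × Bits (Fin k) := AddMonoidHom.mk'
    (fun x => (x.1 + Matrix.vecMulVec x.2 (Pi.single i 1), x.2)) (by
      intro x x'
      refine Prod.ext ?_ rfl
      simp only [Prod.fst_add, Prod.snd_add, Matrix.add_vecMulVec]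
      abel)
  have hshift : Function.Surjective shift := fun x =>
    ⟨(x.1 - Matrix.vecMulVec x.2 (Pi.single i 1), x.2), by simp [shift]⟩
  have hmul : ∀ (R : M) (a : Bits (Fin k)), (R + Matrix.vecMulVec a (Pi.single i 1)) *ᵥ y
      = R *ᵥ y + y i • a := by
    intro R a
    rw [Matrix.add_mulVec, Matrix.vecMulVec_mulVec]
    simp
  refine expect_threshold_wrong_le (Seed.sample c A)
    (fun j j' hj => Seed.sample_pair_surjective c A hc j j' hj)
    (fun x => ∀ r ∈ A, g (x.1 + Matrix.vecMulVec x.2 (Pi.single i 1)) r = (x.1 *ᵥ y + x.2) r)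
    T hT (y i = 1) (fun hy => h1.trans ?_) (fun hy => le_trans (le_of_eq ?_) h2)
  · gcongr
    have h := expect_comp_of_surjective ((AddMonoidHom.fst M (Bits (Fin k))).comp shift)
      (Prod.fst_surjective.comp hshift) fun R => if g R = R *ᵥ y then (1 : ℝ) else 0
    rw [agreement, ← h]
    refine expect_le_expect fun x _ => ?_
    have h3 : (AddMonoidHom.fst M (Bits (Fin k))).comp shift x
        = x.1 + Matrix.vecMulVec x.2 (Pi.single i 1) := rfl
    rw [h3, hmul, hy, one_smul]
    split_ifs with h4 h5
    · rfl
    · exact absurd (fun r _ => congrFun h4 r) h5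
    · exact zero_le_one
    · exact le_rfl
  -- Here the comparison asks whether the mask equals `g R - R *ᵥ y` on `A`, a target fixed by the
  -- query alone.
  · have hy0 : y i = 0 := by
      generalize y i = b at hy
      revert b
      decide
    congr 1
    have h := expect_comp_of_surjective shift hshift
      fun x => if ∀ r ∈ A, (g x.1 - x.1 *ᵥ y) r = x.2 r then (1 : ℝ) else 0
    rw [← univ_product_univ, expect_product (f := fun x : M × Bits (Fin k) =>
      if ∀ r ∈ A, (g x.1 - x.1 *ᵥ y) r = x.2 r then (1 : ℝ) else 0)] at h
    simp only [expect_eq_on, Fintype.expect_const] at h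
    rw [← h]
    refine expect_congr rfl fun x _ => ?_
    have h3 : shift x = (x.1 + Matrix.vecMulVec x.2 (Pi.single i 1), x.2) := rfl
    simp only [h3, hmul, hy0, zero_smul, add_zero, Pi.sub_apply, Pi.add_apply, sub_eq_iff_eq_add']

/-- With the right guess, the whole string is decoded correctly for most seeds. -/
theorem le_expect_seedDecode {m : ℕ}
    (f : Bits (Fin m) → Matrix (Fin k) (Fin n) (ZMod 2) → Bits (Fin k))
    (c : F →ₗ[ZMod 2] Bits (Fin k)) (A : Finset (Fin k))
    (hc : ∀ w : Bits (Fin k), ∃ x, ∀ r ∈ A, c x r = w r) (T : ℕ) (hT : 0 < T) (hnT : 4 * n ≤ T)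
    (z : Bits (Fin m)) (y : Bits (Fin n))
    (h1 : 2 * (T : ℝ) ≤ Fintype.card F * agreement (f z) y)
    (h2 : (Fintype.card F : ℝ) * (1 / 2 ^ A.card) ≤ T / 2) :
    1 / 2 ≤ 𝔼 ω : Seed F n k, if seedDecode f c A T ω (ω.secret y) z = y then (1 : ℝ) else 0 := by
  classical
  -- Union bound: a wrong string has a wrong bit. Each of the `n` bits fails with probability at
  -- most `2 / T`, and `4 * n ≤ T`.
  have key : ∀ ω : Seed F n k,
      1 - ∑ i, (if T ≤ (univ.filter fun j => ∀ r ∈ A,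
        f z ((Seed.sample c A j ω).1 + Matrix.vecMulVec (Seed.sample c A j ω).2 (Pi.single i 1)) r
          = ((Seed.sample c A j ω).1 *ᵥ y + (Seed.sample c A j ω).2) r).card ↔ y i = 1
        then (0 : ℝ) else 1)
      ≤ if seedDecode f c A T ω (ω.secret y) z = y then (1 : ℝ) else 0 := by
    intro ω
    split_ifs with h
    · exact sub_le_self _ (sum_nonneg fun i _ => by split_ifs <;> norm_num)
    · obtain ⟨i, hi⟩ := Function.ne_iff.1 h
      rw [sub_nonpos]
      refine le_trans ?_ (single_le_sum (fun i _ => by split_ifs <;> norm_num) (mem_univ i))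
      rw [if_neg]
      intro h'
      apply hi
      have h3 : ∀ j, (∀ r ∈ A, f z ((Seed.sample c A j ω).1
          + Matrix.vecMulVec (Seed.sample c A j ω).2 (Pi.single i 1)) r
          = ((Seed.sample c A j ω).1 *ᵥ y + (Seed.sample c A j ω).2) r) ↔ ∀ r ∈ A,
          f z ((Seed.sample c A j ω).1
          + Matrix.vecMulVec (Seed.sample c A j ω).2 (Pi.single i 1)) r
          = (c ((ω.secret y).1 + j * (ω.secret y).2) + (Seed.sample c A j ω).2) r := by
        refine fun j => forall₂_congr fun r hr => ?_
        rw [Pi.add_apply, Pi.add_apply, Seed.sample_mulVec c A j ω y r hr]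
      simp_rw [h3] at h'
      rw [seedDecode, thresholdDecode]
      have h4 : ∀ b : ZMod 2, b ≠ 1 → b = 0 := by decide
      split_ifs with h5
      · exact (h'.1 h5).symm
      · exact (h4 _ fun h6 => h5 (h'.2 h6)).symm
  refine le_trans ?_ (expect_le_expect fun ω _ => key ω)
  rw [expect_sub_distrib, expect_sum_comm, Fintype.expect_const]
  have h3 := sum_le_sum fun i (_ : i ∈ univ) => expect_vote_wrong_le (f z) c A hc T hT y h1 h2 i
  have h4 : ∑ i : Fin n, (2 : ℝ) / T ≤ 1 / 2 := by
    have hT' : (0 : ℝ) < T := by exact_mod_cast hT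
    have : 4 * (n : ℝ) ≤ T := by exact_mod_cast hnT
    rw [sum_const, card_univ, Fintype.card_fin, nsmul_eq_mul, ← mul_div_assoc,
      div_le_div_iff₀ hT' two_pos]
    linarith
  linarith

end Correctness

/-! ### Short lists of candidates -/

/-- The size of the circuit for one candidate: there are `2 ^ (h + e)` samples for each of the `n`
bits, and the answers of a circuit of size `s` are compared with `k` bits. -/
def candidateSize (n k s h e : ℕ) : ℕ :=
  n * (2 ^ (h + e) * ((2 ^ (e + 1) + 1) * (s + k + 3)) + (2 ^ (e + 1) + 1))

theorem candidateSize_mono {n k s h h' e : ℕ} (hh : h ≤ h') :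
    candidateSize n k s h e ≤ candidateSize n k s h' e := by
  unfold candidateSize
  gcongr
  norm_num

section

open Finset

variable {Ω Q ι : Type} {orc : Ω → Q → Bits ι → ZMod 2} {m n k s : ℕ}
  {f : Bits (Fin m) → Matrix (Fin k) (Fin n) (ZMod 2) → Bits (Fin k)}

/-- A short list of candidates for strings whose agreement is about `2 ^ (-h)`. -/
theorem exists_candidates_of_scale (hf : ∀ R, Computes orc s fun _ z => f z R) {h e : ℕ}
    (h2 : 2 ≤ h) (hk : h ≤ k) (hn : 2 * n ≤ 2 ^ e) (w : Bits (Fin n) × Bits (Fin m) → ℝ)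
    (hw : ∀ x, 0 ≤ w x) (hs : ∀ x, w x ≠ 0 → 4 ≤ 2 ^ h * agreement (f x.2) x.1) :
    ∃ l : List (Bits (Fin m) → Bits (Fin n)), l.length = 2 ^ (2 + h + 2 * e) ∧
      (∀ D ∈ l, Computes orc (candidateSize n k s h e) fun _ z => D z) ∧
      2 / 2 ^ h * ∑ x, w x ≤ ∑ x, w x * if ∃ D ∈ l, D x.2 = x.1 then 1 else 0 := by
  classical
  obtain ⟨F, _, _, _, c, hF, hc⟩ := exists_field_coordinates k h (h + e) (by omega) (by omega)
  set A : Finset (Fin k) := univ.filter fun r => (r : ℕ) < h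
  have hA : A.card = h := by
    simp only [A, Fin.card_filter_val_lt]
    omega
  have hc' : ∀ w : Bits (Fin k), ∃ x, ∀ r ∈ A, c x r = w r := fun w =>
    (hc w).imp fun x hx r hr => hx r (by simpa [A] using hr)
  have hFF : Fintype.card (F × F) = 2 ^ (2 * (h + e)) := by
    rw [Fintype.card_prod, hF]
    ring
  -- `U` has density `4 / 2 ^ h` in `F × F`, which is possible because `2 ≤ h`. A random translate
  -- of it contains the secret with exactly this probability.
  obtain ⟨U, -, hU⟩ := exists_subset_card_eq (s := (univ : Finset (F × F)))
    (n := 2 ^ (2 + h + 2 * e)) (by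
      rw [card_univ, hFF]
      exact Nat.pow_le_pow_right two_pos (by omega))
  let l : Seed F n k → F × F → List (Bits (Fin m) → Bits (Fin n)) := fun ω u =>
    U.toList.map fun d => seedDecode f c A (2 ^ (e + 1)) ω (u + d)
  have hguess : ∀ v : F × F, 𝔼 u, (if v - u ∈ U then (1 : ℝ) else 0) = 4 / 2 ^ h := by
    intro v
    rw [Fintype.expect_equiv (Equiv.subLeft v) (fun u => if v - u ∈ U then (1 : ℝ) else 0)
      (fun u => if u ∈ U then (1 : ℝ) else 0) fun u => rfl, Fintype.expect_eq_sum_div_card, sum_boole, hFF]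
    simp only [filter_univ_mem, hU]
    push_cast
    rw [div_eq_div_iff (by positivity) (by positivity)]
    ring
  have hx : ∀ x, w x * (2 / 2 ^ h) ≤
      w x * 𝔼 ω, 𝔼 u, if ∃ D ∈ l ω u, D x.2 = x.1 then (1 : ℝ) else 0 := by
    intro x
    by_cases hwx : w x = 0
    · simp [hwx]
    refine mul_le_mul_of_nonneg_left ?_ (hw x)
    -- With `2 ^ (h + e)` samples and `T = 2 ^ (e + 1)`, the expected count is at least `4 * 2 ^ e =
    -- 2 * T` for a bit 1 and equals `2 ^ e = T / 2` for a bit 0.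
    have h3 := le_expect_seedDecode f c A hc' (2 ^ (e + 1)) (by positivity)
      (by rw [pow_succ]; omega) x.2 x.1 (by
        have := hs x hwx
        rw [hF]
        push_cast
        rw [pow_add, pow_add]
        have h5 : (0 : ℝ) < 2 ^ e := by positivity
        nlinarith) (by
        rw [hF, hA]
        push_cast
        rw [pow_add, pow_add]
        apply le_of_eq
        field_simp)
    calc (2 : ℝ) / 2 ^ h = 1 / 2 * (4 / 2 ^ h) := by ring
      _ ≤ _ := mul_le_mul_of_nonneg_right h3 (by positivity)
      _ = 𝔼 ω : Seed F n k, 𝔼 u,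
          (if seedDecode f c A (2 ^ (e + 1)) ω (ω.secret x.1) x.2 = x.1 then (1 : ℝ) else 0) *
            if ω.secret x.1 - u ∈ U then (1 : ℝ) else 0 := by
        simp_rw [← mul_expect, hguess, expect_mul]
      _ ≤ _ := by
        refine expect_le_expect fun ω _ => expect_le_expect fun u _ => ?_
        by_cases h4 : seedDecode f c A (2 ^ (e + 1)) ω (ω.secret x.1) x.2 = x.1
        · by_cases h5 : ω.secret x.1 - u ∈ U
          · rw [if_pos h4, if_pos h5, if_pos, one_mul]
            exact ⟨_, List.mem_map.2 ⟨_, mem_toList.2 h5, rfl⟩, by simpa using h4⟩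
          · rw [if_neg h5, mul_zero]
            split_ifs <;> norm_num
        · rw [if_neg h4, zero_mul]
          split_ifs <;> norm_num
  have hsum : 2 / 2 ^ h * ∑ x, w x ≤
      𝔼 ω, 𝔼 u, ∑ x, w x * if ∃ D ∈ l ω u, D x.2 = x.1 then (1 : ℝ) else 0 := by
    simp_rw [expect_sum_comm, ← mul_expect]
    rw [mul_comm, sum_mul]
    exact sum_le_sum fun x _ => hx x
  -- A seed and a translate that are at least as good as the average can be hardwired.
  obtain ⟨ω, -, hω⟩ := exists_le_of_le_expect univ_nonempty hsum
  obtain ⟨u, -, hu⟩ := exists_le_of_le_expect univ_nonempty hω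
  refine ⟨l ω u, by simp [l, hU], fun D hD => ?_, hu⟩
  obtain ⟨d, -, rfl⟩ := List.mem_map.1 hD
  have h6 := computes_thresholdDecode hf A (2 ^ (e + 1))
    (fun j i => (Seed.sample c A j ω).1 + Matrix.vecMulVec (Seed.sample c A j ω).2 (Pi.single i 1))
    (fun j => c ((u + d).1 + j * (u + d).2) + (Seed.sample c A j ω).2)
  rw [hF] at h6
  exact h6

theorem agreement_le_one (g : Matrix (Fin k) (Fin n) (ZMod 2) → Bits (Fin k))
    (y : Bits (Fin n)) : agreement g y ≤ 1 :=
  expect_le univ_nonempty fun _ _ => by split_ifs <;> norm_num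

set_option maxHeartbeats 1000000 in
/-- If `f` predicts the product of a uniformly random matrix with the secret string better than
with probability `8 / 2 ^ k`, then a short list contains the secret string with probability more
than `1 / 2 ^ k`. -/
theorem exists_candidates (hf : ∀ R, Computes orc s fun _ z => f z R) {e : ℕ}
    (hn : 2 * n ≤ 2 ^ e) (w : Bits (Fin n) × Bits (Fin m) → ℝ) (hw : ∀ x, 0 ≤ w x)
    (hw1 : ∑ x, w x = 1) (hpred : 8 / 2 ^ k < ∑ x, w x * agreement (f x.2) x.1) :
    ∃ l : List (Bits (Fin m) → Bits (Fin n)), l.length ≤ (k + 1) * 2 ^ (2 + k + 2 * e) ∧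
      (∀ D ∈ l, Computes orc (candidateSize n k s k e) fun _ z => D z) ∧
      1 / 2 ^ k < ∑ x, w x * if ∃ D ∈ l, D x.2 = x.1 then 1 else 0 := by
  classical
  set δ : Bits (Fin n) × Bits (Fin m) → ℝ := fun x => agreement (f x.2) x.1
  -- The scale of `x` is the least `h` with `4 ≤ 2 ^ h * δ x`. Scales 0 and 1 do not occur, as `δ x
  -- ≤ 1`.
  let S : ℕ → Bits (Fin n) × Bits (Fin m) → Prop := fun h x =>
    4 ≤ 2 ^ h * δ x ∧ ∀ h' < h, ¬ 4 ≤ 2 ^ h' * δ x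
  have hlist : ∀ h, ∃ l : List (Bits (Fin m) → Bits (Fin n)),
      l.length ≤ 2 ^ (2 + k + 2 * e) ∧
      (∀ D ∈ l, Computes orc (candidateSize n k s k e) fun _ z => D z) ∧
      (h ≤ k → 2 / 2 ^ h * ∑ x, (if S h x then w x else 0) ≤
        ∑ x, (if S h x then w x else 0) * if ∃ D ∈ l, D x.2 = x.1 then 1 else 0) := by
    intro h
    by_cases hh : 2 ≤ h ∧ h ≤ k
    · obtain ⟨l, hl1, hl2, hl3⟩ := exists_candidates_of_scale hf hh.1 hh.2 hn
        (fun x => if S h x then w x else 0)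
        (fun x => by split_ifs <;> simp [hw])
        (fun x hx => by
          by_contra hc
          exact hx (if_neg fun hS => hc hS.1))
      exact ⟨l, hl1.le.trans (Nat.pow_le_pow_right two_pos (by omega)),
        fun D hD => (hl2 D hD).mono (candidateSize_mono hh.2), fun _ => hl3⟩
    · refine ⟨[], by simp, by simp, fun hk => ?_⟩
      have hS : ∀ x, ¬ S h x := by
        intro x hx
        have h1 : h = 0 ∨ h = 1 := by omega
        have h3 := agreement_le_one (f x.2) x.1
        have h4 : 4 ≤ 2 ^ h * agreement (f x.2) x.1 := hx.1
        rcases h1 with rfl | rfl <;> norm_num at h4 <;> linarith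
      simp [hS]
  choose l hl1 hl2 hl3 using hlist
  have hmem : ∀ D, D ∈ (List.range (k + 1)).flatMap l ↔ ∃ h ≤ k, D ∈ l h := by
    simp
  refine ⟨(List.range (k + 1)).flatMap l, ?_, fun D hD => ?_, ?_⟩
  · rw [List.length_flatMap]
    refine (List.sum_le_card_nsmul _ (2 ^ (2 + k + 2 * e)) ?_).trans (by simp)
    intro N hN
    obtain ⟨h, -, rfl⟩ := List.mem_map.1 hN
    exact hl1 h
  · obtain ⟨h, -, hD⟩ := (hmem D).1 hD
    exact hl2 h D hD
  · have hunique : ∀ x h h', S h x → S h' x → h = h' := by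
      intro x h h' hS hS'
      rcases lt_trichotomy h h' with hlt | heq | hlt
      · exact absurd hS.1 (hS'.2 h hlt)
      · exact heq
      · exact absurd hS'.1 (hS.2 h' hlt)
    -- Minimality of the scale gives `2 ^ h * δ x < 8`, so the success `2 / 2 ^ h` exceeds `δ x /
    -- 4`. Pairs without a scale up to `k` have `δ x < 4 / 2 ^ k`, and for them the left side is not
    -- positive.
    have hlower : ∀ x, w x * (δ x / 4 - 1 / 2 ^ k) ≤
        ∑ h ∈ range (k + 1), 2 / 2 ^ h * if S h x then w x else 0 := by
      intro x
      have hnn : ∀ h ∈ range (k + 1), 0 ≤ 2 / 2 ^ h * if S h x then w x else 0 := fun h _ =>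
        mul_nonneg (by positivity) (by split_ifs <;> simp [hw])
      by_cases hx : 4 ≤ 2 ^ k * δ x
      · have hex : ∃ h, 4 ≤ 2 ^ h * δ x := ⟨k, hx⟩
        set h := Nat.find hex with hdef
        have hS : S h x := ⟨Nat.find_spec hex, fun h' hh' => Nat.find_min hex hh'⟩
        have hhk : h ≤ k := Nat.find_min' hex hx
        refine le_trans ?_ (single_le_sum hnn (mem_range.2 (Nat.lt_succ_of_le hhk)))
        rw [if_pos hS, mul_comm]
        refine mul_le_mul_of_nonneg_right ?_ (hw x)
        have h0 : 0 < h := by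
          by_contra h0
          have h1 : h = 0 := by omega
          have h3 : δ x ≤ 1 := agreement_le_one _ _
          have h4 := hS.1
          rw [h1] at h4
          norm_num at h4
          linarith
        have h5 := hS.2 (h - 1) (by omega)
        have h6 : (2 : ℝ) ^ h = 2 ^ (h - 1) * 2 := by
          rw [← pow_succ]
          congr 1
          omega
        have h7 : δ x / 4 ≤ 2 / 2 ^ h := by
          rw [div_le_div_iff₀ (by norm_num) (by positivity), h6]
          nlinarith
        have h8 : (0 : ℝ) < 1 / 2 ^ k := by positivity
        linarith
      · refine le_trans ?_ (sum_nonneg hnn)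
        refine mul_nonpos_of_nonneg_of_nonpos (hw x) ?_
        rw [sub_nonpos, div_le_div_iff₀ (by norm_num) (by positivity)]
        linarith
    have hupper : ∀ x, ∑ h ∈ range (k + 1),
          (if S h x then w x else 0) * (if ∃ D ∈ l h, D x.2 = x.1 then (1 : ℝ) else 0) ≤
        w x * if ∃ D ∈ (List.range (k + 1)).flatMap l, D x.2 = x.1 then 1 else 0 := by
      intro x
      by_cases hx : ∃ h ∈ range (k + 1), S h x ∧ ∃ D ∈ l h, D x.2 = x.1
      · obtain ⟨h, hh, hS, D, hD, hDx⟩ := hx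
        rw [sum_eq_single_of_mem h hh fun h' _ hne => by
          rw [if_neg fun hS' => hne (hunique x h' h hS' hS), zero_mul]]
        rw [if_pos hS, if_pos ⟨D, hD, hDx⟩, if_pos]
        exact ⟨D, (hmem D).2 ⟨h, Nat.lt_succ_iff.1 (mem_range.1 hh), hD⟩, hDx⟩
      · rw [sum_eq_zero]
        · exact mul_nonneg (hw x) (by split_ifs <;> norm_num)
        · intro h hh
          by_cases hS : S h x
          · rw [if_neg fun hD => hx ⟨h, hh, hS, hD⟩, mul_zero]
          · rw [if_neg hS, zero_mul]
    refine lt_of_lt_of_eq (b := ∑ x, w x *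
      if ∃ D ∈ (List.range (k + 1)).flatMap l, D x.2 = x.1 then 1 else 0) ?_ (by congr!)
    calc (1 : ℝ) / 2 ^ k = (8 / 2 ^ k) / 4 - 1 / 2 ^ k := by ring
      _ < (∑ x, w x * δ x) / 4 - 1 / 2 ^ k := by linarith
      _ = ∑ x, w x * (δ x / 4 - 1 / 2 ^ k) := by
        simp_rw [mul_sub, sum_sub_distrib, ← sum_mul, hw1, mul_div_assoc', sum_div, one_mul]
      _ ≤ ∑ x, ∑ h ∈ range (k + 1), 2 / 2 ^ h * (if S h x then w x else 0) :=
        sum_le_sum fun x _ => hlower x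
      _ = ∑ h ∈ range (k + 1), 2 / 2 ^ h * ∑ x, (if S h x then w x else 0) := by
        rw [sum_comm]
        simp_rw [mul_sum]
      _ ≤ ∑ h ∈ range (k + 1), ∑ x, (if S h x then w x else 0) *
          (if ∃ D ∈ l h, D x.2 = x.1 then (1 : ℝ) else 0) :=
        sum_le_sum fun h hh => hl3 h (Nat.lt_succ_iff.1 (mem_range.1 hh))
      _ = ∑ x, ∑ h ∈ range (k + 1), (if S h x then w x else 0) *
          (if ∃ D ∈ l h, D x.2 = x.1 then (1 : ℝ) else 0) := sum_comm
      _ ≤ _ := sum_le_sum fun x _ => hupper x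

end

/-! ### Probabilities as sums and averages -/

section Probability

open Finset

theorem pr_eq_sum {α : Type} [Fintype α] (p : PMF α) (E : α → Prop) [DecidablePred E] :
    pr p E = ∑ a, (p a).toReal * if E a then 1 else 0 := by
  rw [pr, PMF.toOuterMeasure_apply_fintype, ENNReal.toReal_sum fun a _ => ?_]
  · refine sum_congr rfl fun a _ => ?_
    by_cases h : E a <;> simp [h]
  · exact ne_top_of_le_ne_top (p.apply_ne_top a) (Set.indicator_le_self _ _ a)

theorem sum_toReal_eq_one {α : Type} [Fintype α] (p : PMF α) : ∑ a, (p a).toReal = 1 := by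
  rw [← ENNReal.toReal_sum fun a _ => p.apply_ne_top a, ← tsum_fintype (L := .unconditional α),
    p.tsum_coe, ENNReal.toReal_one]

theorem pr_map {α β : Type} (p : PMF α) (f : α → β) (E : β → Prop) :
    pr (p.map f) E = pr p fun a => E (f a) := by
  rw [pr, PMF.toOuterMeasure_map_apply]
  rfl

theorem withUniform_apply {α β : Type} [Fintype β] [Nonempty β] (p : PMF α) (a : α) (b : β) :
    withUniform p β (a, b) = p a * (Fintype.card β : ENNReal)⁻¹ := by
  classical
  rw [withUniform, PMF.bind_apply, tsum_eq_single a]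
  · rw [PMF.map_apply, tsum_eq_single b]
    · simp
    · intro b' hb'
      simp [hb'.symm]
  · intro a' ha'
    rw [mul_eq_zero]
    right
    rw [PMF.map_apply, ENNReal.tsum_eq_zero]
    intro b'
    simp [ha'.symm]

theorem pr_withUniform {α β : Type} [Fintype α] [Fintype β] [Nonempty β] (p : PMF α)
    (E : α × β → Prop) : pr (withUniform p β) E = 𝔼 b, pr p fun a => E (a, b) := by
  classical
  simp_rw [pr_eq_sum]
  rw [Fintype.sum_prod_type_right, Fintype.expect_eq_sum_div_card, sum_div]
  refine sum_congr rfl fun b _ => ?_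
  rw [sum_div]
  refine sum_congr rfl fun a _ => ?_
  rw [withUniform_apply, ENNReal.toReal_mul, ENNReal.toReal_inv, ENNReal.toReal_natCast]
  ring

variable {n m k : ℕ}

theorem pr_condensed (P : PMF (Bits (Fin n) × Bits (Fin m)))
    (E : Bits (Fin k) × Bits (Fin m ⊕ Fin k × Fin n) → Prop) :
    pr (condensed k P) E = 𝔼 R : Matrix (Fin k) (Fin n) (ZMod 2),
      pr P fun x => E (R *ᵥ x.1, Sum.elim x.2 fun ij => R ij.1 ij.2) := by
  rw [condensed, pr_map, pr_withUniform]

theorem condensed_map_snd (P : PMF (Bits (Fin n) × Bits (Fin m))) :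
    (condensed k P).map Prod.snd = (P.map Prod.snd).bind fun z =>
      (PMF.uniformOfFintype (Matrix (Fin k) (Fin n) (ZMod 2))).map fun R =>
        Sum.elim z fun ij => R ij.1 ij.2 := by
  rw [condensed, withUniform, PMF.map_comp, PMF.map_bind, PMF.bind_map]
  congr 1
  funext a
  rw [PMF.map_comp]
  rfl

end Probability

/-! ### The reduction -/

section Reduction

open Finset

variable {n m k : ℕ}

/-- Matrix-vector multiplication by a constant matrix. -/
theorem computes_mulVec {Ω Q ι : Type} {orc : Ω → Q → Bits ι → ZMod 2}
    (R : Matrix (Fin k) (Fin n) (ZMod 2)) :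
    Computes orc (k * (n + 1)) fun _ (x : Bits (Fin n)) => R *ᵥ x := by
  have h := Computes.tuple (orc := orc) (W := Fin n) (s := n + 1)
    (F := fun (r : Fin k) _ x => ∑ i ∈ univ.filter fun i => R r i = 1, x i) fun r =>
      (Computes.parity _).mono (by
        simpa using card_le_univ (univ.filter fun i => R r i = 1))
  refine h.congr (by simp) fun _ x r => ?_
  have hb : ∀ b c : ZMod 2, (if b = 1 then c else 0) = b * c := by decide
  simp [sum_filter, hb, Matrix.mulVec, dotProduct]

/-- The advantage is at most the average over `R` of the advantages with `R` fixed. Each of these is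
attained by a circuit that multiplies by `R`, for `k * (n + 1)` gates, and has two gates for the
constants. -/
theorem indistinguishable_condensed {ε s t : ℝ} {P P' : PMF (Bits (Fin n) × Bits (Fin m))}
    (h : Indistinguishable ε s (P.map joinBits) (P'.map joinBits))
    (hst : t + (k * (n + 1) + 2) ≤ s) :
    Indistinguishable ε t ((condensed k P).map joinBits) ((condensed k P').map joinBits) := by
  intro r C hC
  have key : ∀ R : Matrix (Fin k) (Fin n) (ZMod 2),
      ∃ D : PlainCircuit Unit ((Fin n ⊕ Fin m) ⊕ Fin r), (Circuit.size D : ℝ) ≤ s ∧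
        ∀ v ρ, D.run (Sum.elim (joinBits v) ρ) () = C.run (Sum.elim (joinBits
          (R *ᵥ v.1, Sum.elim v.2 fun ij : Fin k × Fin n => R ij.1 ij.2)) ρ) () := by
    intro R
    obtain ⟨D, hD, hDv⟩ := ((computes_mulVec (orc := fun (_ : Unit) (q : Empty) => q.elim) R).rename
      (fun i => (Sum.inl (Sum.inl i) : (Fin n ⊕ Fin m) ⊕ Fin r))).andThen
        ((Computes.of_plain C).hardwire (W := ((Fin n ⊕ Fin m) ⊕ Fin r) ⊕ Fin k)
          (Sum.elim (Sum.elim (fun i => .inl (.inr i))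
            (Sum.elim (fun i => .inl (.inl (.inl (.inr i)))) fun ij => .inr (R ij.1 ij.2)))
            fun i => .inl (.inl (.inr i))))
    refine ⟨D, ?_, fun v ρ => ?_⟩
    · have : (Circuit.size D : ℝ) ≤ k * (n + 1) + (Circuit.size C + 2) := by exact_mod_cast hD
      linarith
    · have := congrFun (hDv () (Sum.elim (joinBits v) ρ)) ()
      rw [PlainCircuit.run]
      refine this.trans (congrFun (congrArg (PlainCircuit.run C) (funext fun w => ?_)) ())
      rcases w with (i | i | ij) | i <;> rfl
  have hpr : ∀ P₀ : PMF (Bits (Fin n) × Bits (Fin m)),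
      pr (withUniform ((condensed k P₀).map joinBits) (Bits (Fin r)))
          (fun a => C.run (Sum.elim a.1 a.2) () = 1)
        = 𝔼 R : Matrix (Fin k) (Fin n) (ZMod 2), 𝔼 ρ, pr P₀ fun v => C.run (Sum.elim (joinBits
          (R *ᵥ v.1, Sum.elim v.2 fun ij : Fin k × Fin n => R ij.1 ij.2)) ρ) () = 1 := by
    intro P₀
    rw [pr_withUniform, expect_comm]
    simp_rw [pr_map, pr_condensed]
  rw [hpr, hpr, ← expect_sub_distrib]
  refine (abs_expect_le _ _).trans (expect_le univ_nonempty fun R _ => ?_)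
  obtain ⟨D, hD, hDv⟩ := key R
  have := h r D hD
  rw [pr_withUniform, pr_withUniform] at this
  simp_rw [pr_map, hDv] at this
  exact this

/-- A bound on the probability of predicting with an oracle circuit that uses no randomness. -/
theorem sum_predict_le {s κ : ℝ} {P : PMF (Bits (Fin n) × Bits (Fin m))}
    (h : ∀ (r : ℕ) (C : OracleCircuit (Fin n) (Fin n) (Fin m ⊕ Fin r)),
      (Circuit.size C : ℝ) ≤ s →
      pr (withUniform P (Bits (Fin r)))
        (fun a => C.run (eqOracle a.1.1) (Sum.elim a.1.2 a.2) = a.1.1) ≤ κ)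
    {N : ℕ} (hN : (N : ℝ) ≤ s) {F : Bits (Fin n) → Bits (Fin m) → Bits (Fin n)}
    (hF : Computes (fun (y : Bits (Fin n)) (_ : Unit) => eqOracle y) N F) :
    ∑ x, (P x).toReal * (if F x.1 x.2 = x.1 then 1 else 0) ≤ κ := by
  obtain ⟨C, hC, hCF⟩ := hF.rename (Sum.inl : Fin m → Fin m ⊕ Fin 0)
  have h1 := h 0 C (le_trans (by exact_mod_cast hC) hN)
  have h2 : ∀ (y : Bits (Fin n)) (z : Bits (Fin m)) (ρ : Bits (Fin 0)),
      OracleCircuit.run C (eqOracle y) (Sum.elim z ρ) = F y z := fun y z ρ => hCF y _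
  simp_rw [pr_withUniform, h2, Fintype.expect_const, pr_eq_sum] at h1
  exact h1

/-- A string of length `n` can be guessed with probability `1 / 2 ^ n`. -/
theorem le_length_of_unpredictable {s : ℝ} {P : PMF (Bits (Fin n) × Bits (Fin m))}
    (h : ∀ (r : ℕ) (C : OracleCircuit (Fin n) (Fin n) (Fin m ⊕ Fin r)),
      (Circuit.size C : ℝ) ≤ s →
      pr (withUniform P (Bits (Fin r)))
        (fun a => C.run (eqOracle a.1.1) (Sum.elim a.1.2 a.2) = a.1.1) ≤ 1 / 2 ^ k)
    (hs : 2 ≤ s) : k ≤ n := by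
  have h1 : (1 : ℝ) / 2 ^ n ≤ 𝔼 y : Bits (Fin n),
      ∑ x, (P x).toReal * (if y = x.1 then 1 else 0) := by
    rw [expect_sum_comm]
    simp_rw [← mul_expect]
    have : ∀ z : Bits (Fin n), (𝔼 y, if y = z then (1 : ℝ) else 0) = 1 / 2 ^ n := by
      intro z
      rw [Fintype.expect_eq_sum_div_card]
      simp [ZMod.card]
    simp_rw [this, ← sum_mul, sum_toReal_eq_one, one_mul, le_refl]
  obtain ⟨y, -, hy⟩ := exists_le_of_le_expect univ_nonempty h1
  have h2 := (Computes.select (orc := fun (y : Bits (Fin n)) (_ : Unit) => eqOracle y)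
    (id : Fin n → Fin n)).hardwire (W := Fin m) fun i => Sum.inr (y i)
  have h3 := hy.trans (sum_predict_le h (by simpa using hs) h2)
  rw [div_le_div_iff₀ (by positivity) (by positivity), one_mul, one_mul] at h3
  exact (pow_le_pow_iff_right₀ one_lt_two).1 h3

/-- One factor `2 ^ k` comes from the length of the list, the other from the number of samples per
bit. Everything else is polynomial in `n`, because `k ≤ n`. -/
theorem predictor_size_le {τ e : ℕ} (hk : k ≤ n) (hτ : 1 ≤ τ) (he : 2 ^ e ≤ 4 * (n + 1)) :
    (k + 1) * 2 ^ (2 + k + 2 * e) * (candidateSize n k (τ + 2) k e + 1 + n * 2) + n ≤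
      15000 * (n + 1) ^ 7 * 2 ^ (2 * k) * τ := by
  have hK : 1 ≤ 2 ^ k := Nat.one_le_two_pow
  have h1 : (k + 1) * 2 ^ (2 + k + 2 * e) ≤ 64 * (n + 1) ^ 3 * 2 ^ k := by
    calc (k + 1) * 2 ^ (2 + k + 2 * e) = (k + 1) * (4 * 2 ^ k * (2 ^ e) ^ 2) := by ring
      _ ≤ (n + 1) * (4 * 2 ^ k * (4 * (n + 1)) ^ 2) := by gcongr
      _ = _ := by ring
  have h2 : candidateSize n k (τ + 2) k e ≤ 225 * (n + 1) ^ 4 * 2 ^ k * τ := by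
    have h3 : 2 ^ (e + 1) + 1 ≤ 9 * (n + 1) := by
      rw [pow_succ]
      omega
    have h4 : τ + 2 + k + 3 ≤ 6 * (n + 1) * τ := by nlinarith
    have h5 : 1 ≤ (n + 1) ^ 2 * 2 ^ k * τ :=
      Nat.succ_le_of_lt (by positivity)
    calc candidateSize n k (τ + 2) k e
        = n * (2 ^ k * 2 ^ e * ((2 ^ (e + 1) + 1) * (τ + 2 + k + 3)) + (2 ^ (e + 1) + 1)) := by
          rw [candidateSize, pow_add 2 k e]
      _ ≤ (n + 1) * (2 ^ k * (4 * (n + 1)) * (9 * (n + 1) * (6 * (n + 1) * τ)) + 9 * (n + 1)) := by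
          gcongr
          omega
      _ = 216 * (n + 1) ^ 4 * 2 ^ k * τ + 9 * (n + 1) ^ 2 * 1 := by ring
      _ ≤ 216 * (n + 1) ^ 4 * 2 ^ k * τ + 9 * (n + 1) ^ 2 * ((n + 1) ^ 2 * 2 ^ k * τ) := by gcongr
      _ = _ := by ring
  have h6 : n + 1 ≤ (n + 1) ^ 4 * 2 ^ k * τ := by
    calc n + 1 = (n + 1) ^ 1 * 1 * 1 := by ring
      _ ≤ (n + 1) ^ 4 * 2 ^ k * τ := by
        gcongr
        · omega
        · norm_num
  have h7 : (n + 1) ^ 4 * 2 ^ k * τ ≤ (n + 1) ^ 7 * 2 ^ (2 * k) * τ := by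
    gcongr
    · omega
    · norm_num
    · norm_num
    · omega
  calc (k + 1) * 2 ^ (2 + k + 2 * e) * (candidateSize n k (τ + 2) k e + 1 + n * 2) + n
      ≤ 64 * (n + 1) ^ 3 * 2 ^ k * (225 * (n + 1) ^ 4 * 2 ^ k * τ
          + 2 * ((n + 1) ^ 4 * 2 ^ k * τ)) + (n + 1) ^ 7 * 2 ^ (2 * k) * τ := by
        gcongr ?_ * ?_ + ?_ <;> omega
    _ = 14529 * ((n + 1) ^ 7 * 2 ^ (2 * k) * τ) := by ring
    _ ≤ 15000 * ((n + 1) ^ 7 * 2 ^ (2 * k) * τ) := by gcongr; norm_num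
    _ = _ := by ring

theorem unpredictable_condensed {s t : ℝ} {P : PMF (Bits (Fin n) × Bits (Fin m))}
    (h : ∀ (r : ℕ) (C : OracleCircuit (Fin n) (Fin n) (Fin m ⊕ Fin r)),
      (Circuit.size C : ℝ) ≤ s →
      pr (withUniform P (Bits (Fin r)))
        (fun a => C.run (eqOracle a.1.1) (Sum.elim a.1.2 a.2) = a.1.1) ≤ 1 / 2 ^ k)
    (hk : k ≤ n) (ht : 1 ≤ t) (hst : 15000 * (n + 1) ^ 7 * 2 ^ (2 * k) * t ≤ s) (r : ℕ)
    (C : PlainCircuit (Fin k) ((Fin m ⊕ Fin k × Fin n) ⊕ Fin r)) (hC : (Circuit.size C : ℝ) ≤ t) :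
    pr (withUniform (condensed k P) (Bits (Fin r)))
      (fun a => C.run (Sum.elim a.1.2 a.2) = a.1.1) ≤ 8 / 2 ^ k := by
  classical
  by_contra! hlt
  rw [pr_withUniform] at hlt
  -- Fixing the best random bits makes the predictor a deterministic function of `z` and `R`.
  obtain ⟨ρ, -, hρ⟩ := exists_lt_of_lt_expect univ_nonempty hlt
  rw [pr_condensed] at hρ
  let f : Bits (Fin m) → Matrix (Fin k) (Fin n) (ZMod 2) → Bits (Fin k) := fun z R =>
    C.run (Sum.elim (Sum.elim z fun ij => R ij.1 ij.2) ρ)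
  set τ := ⌊t⌋₊
  have hf : ∀ R, Computes (fun (y : Bits (Fin n)) (_ : Unit) => eqOracle y) (τ + 2)
      fun _ z => f z R := by
    intro R
    have h1 := (Computes.of_plain (orc := fun (y : Bits (Fin n)) (_ : Unit) => eqOracle y)
      C).hardwire (W := Fin m)
        (Sum.elim (Sum.elim Sum.inl fun ij => .inr (R ij.1 ij.2)) fun i => .inr (ρ i))
    refine h1.congr (Nat.add_le_add_right (Nat.le_floor hC) 2) fun _ z i => ?_
    simp only [f]
    congr 2
    funext w
    rcases w with (i | ij) | i <;> rfl
  obtain ⟨e, he1, he2⟩ : ∃ e, 2 * n ≤ 2 ^ e ∧ 2 ^ e ≤ 4 * (n + 1) := by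
    refine ⟨Nat.size (2 * n), (Nat.lt_size_self _).le, ?_⟩
    rcases Nat.eq_zero_or_pos n with rfl | hn
    · simp
    · have h1 : 2 ^ (Nat.size (2 * n) - 1) ≤ 2 * n := by
        rw [← Nat.lt_size]
        have : 0 < Nat.size (2 * n) := Nat.size_pos.2 (by omega)
        omega
      have h2 : 2 ^ Nat.size (2 * n) = 2 ^ (Nat.size (2 * n) - 1) * 2 := by
        rw [← pow_succ]
        congr 1
        have : 0 < Nat.size (2 * n) := Nat.size_pos.2 (by omega)
        omega
      omega
  obtain ⟨l, hl1, hl2, hl3⟩ := exists_candidates hf he1 (fun x => (P x).toReal)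
    (fun x => ENNReal.toReal_nonneg) (sum_toReal_eq_one P) (by
      simp_rw [agreement, mul_expect]
      rw [← expect_sum_comm]
      simpa only [pr_eq_sum] using hρ)
  obtain ⟨F, hF, hFv⟩ := Computes.search l hl2
  have hτ : 1 ≤ τ := Nat.le_floor (by simpa using ht)
  have hsize := predictor_size_le hk hτ he2
  have h1 := sum_predict_le h (le_trans ?_ hst) hF
  · refine absurd hl3 (not_lt.2 (le_trans (sum_le_sum fun x _ => ?_) h1))
    refine mul_le_mul_of_nonneg_left ?_ ENNReal.toReal_nonneg
    rw [hFv]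
    split_ifs with h2 h3
    · exact le_rfl
    · exact absurd rfl h3
    · exact zero_le_one
    · exact le_rfl
  · have h2 : ((l.length * (candidateSize n k (τ + 2) k e + 1 + Fintype.card (Fin n) * 2)
        + Fintype.card (Fin n) : ℕ) : ℝ) ≤ (15000 * (n + 1) ^ 7 * 2 ^ (2 * k) * τ : ℕ) := by
      rw [Fintype.card_fin]
      exact_mod_cast (Nat.add_le_add_right (Nat.mul_le_mul_right _ hl1) n).trans hsize
    refine h2.trans ?_
    push_cast
    have h3 : (τ : ℝ) ≤ t := Nat.floor_le (by linarith)
    gcongr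

end Reduction

theorem theorem1 :
    ∃ p : MvPolynomial (Fin 2) ℕ, (∀ m n : ℕ, 0 < MvPolynomial.eval ![m, n] p) ∧
      ∀ (n m k : ℕ) (ε s t : ℝ) (P : PMF (Bits (Fin n) × Bits (Fin m))),
        t = s / (2 ^ (2 * k) * (MvPolynomial.eval ![m, n] p : ℝ)) → 1 ≤ t →
        ListUnpredEntropyGE ε s k P →
        UnpredEntropyGE ε t (k - 3) (condensed k P) := by
  have heval : ∀ m n : ℕ, MvPolynomial.eval ![m, n]
      (MvPolynomial.C 15000 * (MvPolynomial.X 1 + 1) ^ 7 : MvPolynomial (Fin 2) ℕ)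
        = 15000 * (n + 1) ^ 7 := by
    intro m n
    simp
  refine ⟨MvPolynomial.C 15000 * (MvPolynomial.X 1 + 1) ^ 7, fun m n => ?_, ?_⟩
  · rw [heval]
    positivity
  rintro n m k ε s t P hts ht ⟨P', hsnd, hind, hpred⟩
  rw [heval] at hts
  push_cast at hts
  have hs : 15000 * ((n : ℝ) + 1) ^ 7 * 2 ^ (2 * k) * t = s := by
    rw [hts]
    field_simp
  have hpred' : ∀ (r : ℕ) (C : OracleCircuit (Fin n) (Fin n) (Fin m ⊕ Fin r)),
      (Circuit.size C : ℝ) ≤ s → pr (withUniform P' (Bits (Fin r)))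
        (fun a => C.run (eqOracle a.1.1) (Sum.elim a.1.2 a.2) = a.1.1) ≤ 1 / 2 ^ k := by
    intro r C hC
    refine (hpred r C hC).trans (le_of_eq ?_)
    rw [Real.rpow_neg two_pos.le, Real.rpow_natCast, one_div]
  have hq : (1 : ℝ) ≤ (n + 1 : ℝ) := by
    have : (0 : ℝ) ≤ n := Nat.cast_nonneg n
    linarith
  have hsq : 15000 * ((n : ℝ) + 1) ^ 2 * t ≤ s := by
    rw [← hs]
    have h1 : ((n : ℝ) + 1) ^ 2 ≤ (n + 1) ^ 7 := pow_le_pow_right₀ hq (by norm_num)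
    have h2 : (1 : ℝ) ≤ 2 ^ (2 * k) := one_le_pow₀ one_le_two
    calc 15000 * ((n : ℝ) + 1) ^ 2 * t = 15000 * ((n : ℝ) + 1) ^ 2 * 1 * t := by ring
      _ ≤ _ := by gcongr
  have hq2 : 1 ≤ ((n : ℝ) + 1) ^ 2 := one_le_pow₀ hq
  -- This bounds every polynomial factor in `k` by one in `n`; the polynomial does not involve `m`.
  have hk : k ≤ n := le_length_of_unpredictable hpred' (by nlinarith)
  refine ⟨condensed k P', ?_, indistinguishable_condensed hind ?_, fun r C hC => ?_⟩
  · rw [condensed_map_snd, condensed_map_snd, hsnd]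
  · have hkn : (k : ℝ) ≤ n := by exact_mod_cast hk
    have h1 : (k : ℝ) * (n + 1) ≤ (n + 1) ^ 2 := by nlinarith
    nlinarith
  · refine (unpredictable_condensed hpred' hk ht hs.le r C hC).trans (le_of_eq ?_)
    rw [neg_sub, Real.rpow_sub two_pos, Real.rpow_natCast]
    norm_num
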